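/- Let $M$ be a smooth (i.e. $C^\infty$) finite-dimensional manifold without boundary and let $p\ge 0$ be an integer. For $q\ge 0$ and $k\in\{1,2\}$ let $J^k_qM$ be the manifold of $k$-jets $j^k\varphi$ at the origin of smooth maps $\varphi:\mathbb R^q\to M$: two maps have the same $k$-jet if they have the same value at $0$ and, in a chart of $M$ around that value, the same partial derivatives at $0$ up to order $k$; the charts of $J^1_qM$ and $J^2_qM$ induced by a chart $e$ of $M$ are $j^1\varphi\mapsto (e(\varphi(0)),D(e\circ\varphi)(0))$ and $j^2\varphi\mapsto (e(\varphi(0)),D(e\circ\varphi)(0),D^2(e\circ\varphi)(0))$. Identify $\mathbb R^{2p}=\mathbb R^p\times\mathbb R^p$, and let $\mathfrak f:\mathbb R^{2p}\to\mathbb R^{2p}$, $\mathfrak f(u,w)=(w,u)$, be the flip. Let $\Lambda:J^2_{2p}M\to J^1_p(J^1_pM)$ be the map $\Lambda(j^2\varphi)=j^1\Phi$, where $\Phi:\mathbb R^p\to J^1_pM$, $\Phi(u)=j^1(\varphi_u)$ and $\varphi_u(w)=\varphi(u,w)$. Then $\hat\ell(j^2\varphi)=j^2(\varphi\circ\mathfrak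 f)$ is a well-defined diffeomorphism $\hat\ell:J^2_{2p}M\to J^2_{2p}M$ and $\hat\ell\circ\hat\ell=\mathrm{id}$. Moreover, there is exactly one map $\ell:J^1_p(J^1_pM)\to J^1_p(J^1_pM)$ with $\ell\circ\Lambda=\Lambda\circ\hat\ell$; it is a diffeomorphism and $\ell\circ\ell=\mathrm{id}$. -/

import Mathlib

open scoped Manifold ContDiff Topology

noncomputable section

namespace JetBundle

/-! ### Taylor data at the origin of maps between vector spaces -/

section Linear

variable (V E : Type*) [NormedAddCommGroup V] [NormedSpace ℝ V]
  [NormedAddCommGroup E] [NormedSpace ℝ E]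

/-- `S₂(V; E)`: the symmetric bilinear maps `V × V → E`. -/
def SymBilin : Submodule ℝ (V →L[ℝ] V →L[ℝ] E) where
  carrier := {B | ∀ v w, B v w = B w v}
  add_mem' := by
    intro a b ha hb v w
    simp [ha v w, hb v w]
  zero_mem' := by
    intro v w
    simp
  smul_mem' := by
    intro c a ha v w
    simp [ha v w]

instance : NormedAddCommGroup (SymBilin V E) := inferInstance
instance : NormedSpace ℝ (SymBilin V E) :=
  @Submodule.normedSpace ℝ ℝ _ _ _ (V →L[ℝ] V →L[ℝ] E) _ _ _ _ (SymBilin V E)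

/-- The model space `E × L(V, E)` of the manifold of `1`-jets. -/
abbrev Model1 := E × (V →L[ℝ] E)

/-- The model space `E × L(V, E) × S₂(V; E)` of the manifold of `2`-jets. -/
abbrev Model2 := E × (V →L[ℝ] E) × SymBilin V E

variable {V E}

/-- The symmetrization `B ↦ (B + Bᵗ) / 2`. It is the identity on symmetric bilinear maps, see
`symPart_of_symm`; it only serves to regard symmetric bilinear maps as elements of `S₂(V; E)`. -/
def symPart (B : V →L[ℝ] V →L[ℝ] E) : SymBilin V E :=
  ⟨(2 : ℝ)⁻¹ • (B + B.flip), fun v w => by simp [add_comm]⟩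

theorem contDiff_symPart : ContDiff ℝ ∞ (symPart : (V →L[ℝ] V →L[ℝ] E) → SymBilin V E) := by
  refine IsBoundedLinearMap.contDiff (IsLinearMap.with_bound ⟨?_, ?_⟩ 1 ?_)
  · intro A B
    ext v w
    simp [symPart]
    module
  · intro c B
    ext v w
    simp [symPart]
    module
  · intro B
    refine ContinuousLinearMap.opNorm_le_bound₂ _ (by positivity) fun v w => ?_
    change ‖(2 : ℝ)⁻¹ • (B v w + B w v)‖ ≤ _
    rw [norm_smul, Real.norm_of_nonneg (by norm_num)]
    have h1 := B.le_opNorm₂ v w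
    have h2 := B.le_opNorm₂ w v
    have h3 := norm_add_le (B v w) (B w v)
    linarith
theorem contDiff_symBilin_coe : ContDiff ℝ ∞ (fun B : SymBilin V E => (B : V →L[ℝ] V →L[ℝ] E)) :=
  IsBoundedLinearMap.contDiff (IsLinearMap.with_bound ⟨fun _ _ => rfl, fun _ _ => rfl⟩ 1 fun B => by
    rw [one_mul]; rfl)

theorem symPart_of_symm {B : V →L[ℝ] V →L[ℝ] E} (hB : ∀ v w, B v w = B w v) :
    (symPart B : V →L[ℝ] V →L[ℝ] E) = B := by
  ext v w
  simp [symPart, hB w v]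
  module

@[simp] theorem symPart_coe (B : SymBilin V E) : symPart (B : V →L[ℝ] V →L[ℝ] E) = B :=
  Subtype.ext (symPart_of_symm B.2)

/-- The value and the first derivative at the origin. -/
def taylor1 (f : V → E) : Model1 V E := (f 0, fderiv ℝ f 0)

/-- The value, the first and the second derivative at the origin (the latter is symmetric if `f` is
smooth near the origin, so that `symPart` does not change it). -/
def taylor2 (f : V → E) : Model2 V E :=
  (f 0, fderiv ℝ f 0, symPart (fderiv ℝ (fderiv ℝ f) 0))

theorem coe_taylor2 {f : V → E} (hf : ContDiffAt ℝ ∞ f 0) :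
    ((taylor2 f).2.2 : V →L[ℝ] V →L[ℝ] E) = fderiv ℝ (fderiv ℝ f) 0 :=
  symPart_of_symm fun v w => (hf.isSymmSndFDerivAt (by simpa using (ENat.LEInfty.out : (2 : ℕ∞ω) ≤ ∞))) v w

variable {F : Type*} [NormedAddCommGroup F] [NormedSpace ℝ F]

/-- The effect of a map `τ` on first order Taylor data: `(x, A) ↦ (τ x, Dτ(x) ∘ A)`. -/
def push1 (τ : E → F) (y : Model1 V E) : Model1 V F := (τ y.1, (fderiv ℝ τ y.1).comp y.2)

/-- The effect of a map `τ` on second order Taylor data: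
`(x, A, B) ↦ (τ x, Dτ(x) ∘ A, Dτ(x) ∘ B + D²τ(x) ∘ (A × A))`. -/
def push2 (τ : E → F) (y : Model2 V E) : Model2 V F :=
  (τ y.1, (fderiv ℝ τ y.1).comp y.2.1,
    symPart ((ContinuousLinearMap.compL ℝ V E F (fderiv ℝ τ y.1)).comp
        (y.2.2 : V →L[ℝ] V →L[ℝ] E) +
      ((ContinuousLinearMap.compL ℝ V E F).flip y.2.1).comp
        ((fderiv ℝ (fderiv ℝ τ) y.1).comp y.2.1)))

theorem taylor1_comp {τ : E → F} {f : V → E} (hτ : ContDiffAt ℝ ∞ τ (f 0))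
    (hf : ContDiffAt ℝ ∞ f 0) : taylor1 (τ ∘ f) = push1 τ (taylor1 f) := by
  simp only [taylor1, push1, Function.comp_apply]
  rw [fderiv_comp _ (hτ.differentiableAt (by simp)) (hf.differentiableAt (by simp))]

theorem taylor2_comp {τ : E → F} {f : V → E} (hτ : ContDiffAt ℝ ∞ τ (f 0))
    (hf : ContDiffAt ℝ ∞ f 0) : taylor2 (τ ∘ f) = push2 τ (taylor2 f) := by
  have h1 : fderiv ℝ (τ ∘ f) =ᶠ[𝓝 0] fun u => (fderiv ℝ τ (f u)).comp (fderiv ℝ f u) := by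
    have hτ' : ∀ᶠ y in 𝓝 (f 0), DifferentiableAt ℝ τ y :=
      ((hτ.of_le (m := 1) (by simp)).eventually
        (by simp : (1 : ℕ∞ω) ≠ ∞)).mono
        fun y hy => hy.differentiableAt (by simp)
    have hf' : ∀ᶠ u in 𝓝 (0 : V), DifferentiableAt ℝ f u :=
      ((hf.of_le (m := 1) (by simp)).eventually
        (by simp : (1 : ℕ∞ω) ≠ ∞)).mono
        fun y hy => hy.differentiableAt (by simp)
    filter_upwards [hf', hf.continuousAt.eventually hτ'] with u hu hu'
    exact fderiv_comp _ hu' hu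
  have hdf : HasFDerivAt (fderiv ℝ f) (fderiv ℝ (fderiv ℝ f) 0) 0 :=
    ((hf.fderiv_right (m := ∞) (by simp)).differentiableAt (by simp)).hasFDerivAt
  have hdτ : HasFDerivAt (fderiv ℝ τ) (fderiv ℝ (fderiv ℝ τ) (f 0)) (f 0) :=
    ((hτ.fderiv_right (m := ∞) (by simp)).differentiableAt (by simp)).hasFDerivAt
  have hc : HasFDerivAt (fun u => fderiv ℝ τ (f u))
      ((fderiv ℝ (fderiv ℝ τ) (f 0)).comp (fderiv ℝ f 0)) 0 :=
    hdτ.comp (0 : V) (hf.differentiableAt (by simp)).hasFDerivAt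
  have h2 : fderiv ℝ (fderiv ℝ (τ ∘ f)) 0 = _ := h1.fderiv_eq.trans (hc.clm_comp hdf).fderiv
  have h3 := coe_taylor2 hf
  simp only [taylor2, push2, Function.comp_apply] at h3 ⊢
  rw [h2, h3, fderiv_comp _ (hτ.differentiableAt (by simp)) (hf.differentiableAt (by simp))]

theorem contDiffOn_push1 {τ : E → F} {s : Set E} (hs : IsOpen s) (hτ : ContDiffOn ℝ ∞ τ s) :
    ContDiffOn ℝ ∞ (push1 τ : Model1 V E → Model1 V F) (Prod.fst ⁻¹' s) := by
  have hm : Set.MapsTo (Prod.fst : Model1 V E → E) (Prod.fst ⁻¹' s) s := fun y hy => hy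
  refine (hτ.comp contDiff_fst.contDiffOn hm).prodMk ?_
  exact ((hτ.fderiv_of_isOpen hs (m := ∞) (by simp)).comp contDiff_fst.contDiffOn hm).clm_comp
    contDiff_snd.contDiffOn

theorem contDiffOn_push2 {τ : E → F} {s : Set E} (hs : IsOpen s) (hτ : ContDiffOn ℝ ∞ τ s) :
    ContDiffOn ℝ ∞ (push2 τ : Model2 V E → Model2 V F) (Prod.fst ⁻¹' s) := by
  have hm : Set.MapsTo (Prod.fst : Model2 V E → E) (Prod.fst ⁻¹' s) s := fun y hy => hy
  have hτ1 := hτ.fderiv_of_isOpen hs (m := ∞) (by simp)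
  have hτ2 := hτ1.fderiv_of_isOpen hs (m := ∞) (by simp)
  have hA : ContDiff ℝ ∞ (fun y : Model2 V E => y.2.1) := contDiff_fst.comp contDiff_snd
  have hB : ContDiff ℝ ∞ (fun y : Model2 V E => (y.2.2 : V →L[ℝ] V →L[ℝ] E)) :=
    contDiff_symBilin_coe.comp (contDiff_snd.comp contDiff_snd)
  have h1 := hτ1.comp contDiff_fst.contDiffOn hm
  have h2 := hτ2.comp contDiff_fst.contDiffOn hm
  refine (hτ.comp contDiff_fst.contDiffOn hm).prodMk ((h1.clm_comp hA.contDiffOn).prodMk ?_)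
  refine contDiff_symPart.comp_contDiffOn ?_
  refine ContDiffOn.add ?_ ?_
  · exact ((ContinuousLinearMap.compL ℝ V E F).contDiff.comp_contDiffOn h1).clm_comp
      hB.contDiffOn
  · exact ((ContinuousLinearMap.compL ℝ V E F).flip.contDiff.comp hA).contDiffOn.clm_comp
      (h2.clm_comp hA.contDiffOn)

end Linear

/-! ### Smooth maps from a vector space to a manifold, read in charts -/

section Charts

variable {E : Type*} [NormedAddCommGroup E] [NormedSpace ℝ E]
  {V : Type*} [NormedAddCommGroup V] [NormedSpace ℝ V]
  {M : Type*} [TopologicalSpace M] [ChartedSpace E M]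

theorem chart_change {e e' : OpenPartialHomeomorph M E}
    (φ : C^∞⟮𝓘(ℝ, V), V; 𝓘(ℝ, E), M⟯) (h : φ 0 ∈ e.source) :
    e' ∘ φ =ᶠ[𝓝 0] (e' ∘ e.symm) ∘ (e ∘ φ) := by
  have : ∀ᶠ u in 𝓝 (0 : V), φ u ∈ e.source :=
    φ.contMDiff.continuous.continuousAt.eventually (e.open_source.mem_nhds h)
  filter_upwards [this] with u hu
  simp [hu]

theorem _root_.Filter.EventuallyEq.taylor1_eq {f g : V → E} (h : f =ᶠ[𝓝 0] g) :
    taylor1 f = taylor1 g := by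
  simp only [taylor1, h.fderiv_eq, h.eq_of_nhds]

theorem _root_.Filter.EventuallyEq.taylor2_eq {f g : V → E} (h : f =ᶠ[𝓝 0] g) :
    taylor2 f = taylor2 g := by
  simp only [taylor2, h.fderiv_eq, h.fderiv.fderiv_eq, h.eq_of_nhds]

variable [IsManifold 𝓘(ℝ, E) ∞ M]

theorem contDiffAt_chart_comp {e : OpenPartialHomeomorph M E} (he : e ∈ atlas E M)
    (φ : C^∞⟮𝓘(ℝ, V), V; 𝓘(ℝ, E), M⟯) {u : V} (hu : φ u ∈ e.source) :
    ContDiffAt ℝ ∞ (e ∘ φ) u := by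
  rw [← contMDiffAt_iff_contDiffAt]
  exact (contMDiffAt_of_mem_maximalAtlas (IsManifold.subset_maximalAtlas he) hu).comp u
    φ.contMDiff.contMDiffAt

theorem contDiffOn_transition {e e' : OpenPartialHomeomorph M E} (he : e ∈ atlas E M)
    (he' : e' ∈ atlas E M) : ContDiffOn ℝ ∞ (e' ∘ e.symm) (e.symm ≫ₕ e').source := by
  rw [← contMDiffOn_iff_contDiffOn]
  refine (contMDiffOn_of_mem_maximalAtlas (IsManifold.subset_maximalAtlas he')).comp
    ((contMDiffOn_symm_of_mem_maximalAtlas (IsManifold.subset_maximalAtlas he)).mono ?_) ?_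
  · intro x hx
    simpa using hx.1
  · intro x hx
    simpa using hx.2

theorem contDiffAt_transition {e e' : OpenPartialHomeomorph M E} (he : e ∈ atlas E M)
    (he' : e' ∈ atlas E M) {x : M} (hx : x ∈ e.source) (hx' : x ∈ e'.source) :
    ContDiffAt ℝ ∞ (e' ∘ e.symm) (e x) :=
  (contDiffOn_transition he he').contDiffAt
    ((e.symm ≫ₕ e').open_source.mem_nhds (by simp [hx, hx']))

theorem taylor1_chart_change {e e' : OpenPartialHomeomorph M E} (he : e ∈ atlas E M)
    (he' : e' ∈ atlas E M) (φ : C^∞⟮𝓘(ℝ, V), V; 𝓘(ℝ, E), M⟯) (h : φ 0 ∈ e.source)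
    (h' : φ 0 ∈ e'.source) : taylor1 (e' ∘ φ) = push1 (e' ∘ e.symm) (taylor1 (e ∘ φ)) :=
  (chart_change φ h).taylor1_eq.trans
    (taylor1_comp (contDiffAt_transition he he' h h') (contDiffAt_chart_comp he φ h))

theorem taylor2_chart_change {e e' : OpenPartialHomeomorph M E} (he : e ∈ atlas E M)
    (he' : e' ∈ atlas E M) (φ : C^∞⟮𝓘(ℝ, V), V; 𝓘(ℝ, E), M⟯) (h : φ 0 ∈ e.source)
    (h' : φ 0 ∈ e'.source) : taylor2 (e' ∘ φ) = push2 (e' ∘ e.symm) (taylor2 (e ∘ φ)) :=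
  (chart_change φ h).taylor2_eq.trans
    (taylor2_comp (contDiffAt_transition he he' h h') (contDiffAt_chart_comp he φ h))

/-- Every germ at the origin of a smooth map into a chart domain extends to a globally defined
smooth map into the manifold. -/
theorem exists_contMDiffMap [FiniteDimensional ℝ V] {e : OpenPartialHomeomorph M E}
    (he : e ∈ atlas E M) {P : V → E} (hP : ContDiff ℝ ∞ P) (h0 : P 0 ∈ e.target) :
    ∃ φ : C^∞⟮𝓘(ℝ, V), V; 𝓘(ℝ, E), M⟯, φ 0 ∈ e.source ∧ e ∘ φ =ᶠ[𝓝 0] P := by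
  obtain ⟨r, hr, hrP⟩ := Metric.mem_nhds_iff.1
    (hP.continuous.continuousAt.preimage_mem_nhds (e.open_target.mem_nhds h0))
  let χ : ContDiffBump (0 : V) := ⟨r / 2, r, by positivity, by linarith⟩
  have hmem : ∀ u : V, P (χ u • u) ∈ e.target := by
    intro u
    apply hrP
    rw [mem_ball_zero_iff, norm_smul, Real.norm_of_nonneg χ.nonneg]
    by_cases hu : ‖u‖ < r
    · exact (mul_le_of_le_one_left (norm_nonneg u) χ.le_one).trans_lt hu
    · rw [χ.zero_of_le_dist (by simpa [χ] using hu)]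
      simpa using hr
  have hg : ContDiff ℝ ∞ (fun u : V => P (χ u • u)) := hP.comp (χ.contDiff.smul contDiff_id)
  refine ⟨⟨fun u => e.symm (P (χ u • u)), ?_⟩, ?_, ?_⟩
  · exact (contMDiffOn_symm_of_mem_maximalAtlas
      (IsManifold.subset_maximalAtlas he)).comp_contMDiff hg.contMDiff hmem
  · exact e.map_target (hmem 0)
  · filter_upwards [χ.eventuallyEq_one] with u hu
    simp only [Function.comp_apply, ContMDiffMap.coeFn_mk]
    rw [e.right_inv (hmem u), hu]
    simp

theorem exists_taylor1 [FiniteDimensional ℝ V] {e : OpenPartialHomeomorph M E}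
    (he : e ∈ atlas E M) {y : Model1 V E} (hy : y.1 ∈ e.target) :
    ∃ φ : C^∞⟮𝓘(ℝ, V), V; 𝓘(ℝ, E), M⟯, φ 0 ∈ e.source ∧ taylor1 (e ∘ φ) = y := by
  obtain ⟨φ, h, h'⟩ := exists_contMDiffMap he (P := fun u => y.1 + y.2 u)
    (contDiff_const.add y.2.contDiff) (by simpa using hy)
  refine ⟨φ, h, h'.taylor1_eq.trans ?_⟩
  refine Prod.ext (by simp [taylor1]) ?_
  simp [taylor1]

theorem exists_taylor2 [FiniteDimensional ℝ V] {e : OpenPartialHomeomorph M E}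
    (he : e ∈ atlas E M) {y : Model2 V E} (hy : y.1 ∈ e.target) :
    ∃ φ : C^∞⟮𝓘(ℝ, V), V; 𝓘(ℝ, E), M⟯, φ 0 ∈ e.source ∧ taylor2 (e ∘ φ) = y := by
  obtain ⟨x, A, B⟩ := y
  obtain ⟨B, hB⟩ := B
  have hP : ∀ u : V, HasFDerivAt (fun u => x + (A u + (2 : ℝ)⁻¹ • B u u)) (A + B u) u := by
    intro u
    have h := (((B.hasFDerivAt (x := u)).clm_apply (hasFDerivAt_id u)).const_smul
      ((2 : ℝ)⁻¹)).const_add x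
    have h2 := (((A.hasFDerivAt (x := u)).add (((B.hasFDerivAt (x := u)).clm_apply
      (hasFDerivAt_id u)).const_smul ((2 : ℝ)⁻¹)))).const_add x
    refine h2.congr_fderiv ?_
    ext v
    simp [hB v u]
    module
  have hP' : fderiv ℝ (fun u => x + (A u + (2 : ℝ)⁻¹ • B u u)) = fun u => A + B u :=
    funext fun u => (hP u).fderiv
  obtain ⟨φ, h, h'⟩ := exists_contMDiffMap he
    (P := fun u => x + (A u + (2 : ℝ)⁻¹ • B u u))
    (contDiff_const.add (A.contDiff.add ((B.contDiff.clm_apply contDiff_id).const_smul _)))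
    (by simpa using hy)
  refine ⟨φ, h, h'.taylor2_eq.trans ?_⟩
  refine Prod.ext (by simp [taylor2]) (Prod.ext ?_ (Subtype.ext ?_))
  · rw [taylor2, hP']
    simp
  · simp only [taylor2, hP']
    rw [fderiv_const_add, B.fderiv]
    exact symPart_of_symm hB

end Charts

/-! ### The manifold of 1-jets -/

section Jet1

variable (E : Type*) [NormedAddCommGroup E] [NormedSpace ℝ E]
  (V : Type*) [NormedAddCommGroup V] [NormedSpace ℝ V]
  (M : Type*) [TopologicalSpace M] [ChartedSpace E M]

/-- Two smooth maps `V → M` are equivalent if they have the same value at the origin and, in a chart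
around that value, the same first partial derivatives at the origin. The chart used is the preferred
one; by `Jet1.j1_eq_iff` every chart of the atlas gives the same relation. -/
def jet1Setoid : Setoid C^∞⟮𝓘(ℝ, V), V; 𝓘(ℝ, E), M⟯ where
  r φ ψ := φ 0 = ψ 0 ∧
    fderiv ℝ (chartAt E (φ 0) ∘ φ) 0 = fderiv ℝ (chartAt E (φ 0) ∘ ψ) 0
  iseqv := by
    refine ⟨fun φ => ⟨rfl, rfl⟩, ?_, ?_⟩
    · rintro φ ψ ⟨h0, h1⟩
      exact ⟨h0.symm, by rw [← h0, h1]⟩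
    · rintro φ ψ χ ⟨h0, h1⟩ ⟨h0', h1'⟩
      exact ⟨h0.trans h0', by rw [h1, h0, h1']⟩

/-- The set of `1`-jets at the origin of smooth maps `V → M`, for a manifold `M` modelled on `E`.
For `V = ℝᵖ` this is `J¹ₚ M`. -/
def Jet1 : Type _ := Quotient (jet1Setoid E V M)

variable {E V M}

/-- The `1`-jet `j¹φ` of a smooth map `φ : V → M` at the origin. -/
def j1 (φ : C^∞⟮𝓘(ℝ, V), V; 𝓘(ℝ, E), M⟯) : Jet1 E V M := Quotient.mk (jet1Setoid E V M) φ

namespace Jet1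

/-- The bundle projection `j¹φ ↦ φ(0)`. -/
def base : Jet1 E V M → M := Quotient.lift (fun φ => φ 0) fun _ _ h => h.1

@[simp] theorem base_j1 (φ : C^∞⟮𝓘(ℝ, V), V; 𝓘(ℝ, E), M⟯) : base (j1 φ) = φ 0 := rfl

/-- A smooth map representing a given jet. -/
def rep (z : Jet1 E V M) : C^∞⟮𝓘(ℝ, V), V; 𝓘(ℝ, E), M⟯ := Quotient.out z

@[simp] theorem j1_rep (z : Jet1 E V M) : j1 z.rep = z := Quotient.out_eq z

@[simp] theorem rep_zero (z : Jet1 E V M) : z.rep 0 = z.base := by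
  conv_rhs => rw [← j1_rep z]
  rfl

variable [IsManifold 𝓘(ℝ, E) ∞ M]

/-- Equality of `1`-jets can be tested in any chart. -/
theorem j1_eq_iff {e : OpenPartialHomeomorph M E} (he : e ∈ atlas E M)
    {φ ψ : C^∞⟮𝓘(ℝ, V), V; 𝓘(ℝ, E), M⟯} (hφ : φ 0 ∈ e.source) (hψ : ψ 0 ∈ e.source) :
    j1 φ = j1 ψ ↔ taylor1 (e ∘ φ) = taylor1 (e ∘ ψ) := by
  have hc := chart_mem_atlas E (φ 0)
  have hφc := mem_chart_source E (φ 0)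
  constructor
  · intro h
    obtain ⟨h0, h1⟩ := Quotient.exact h
    have hψc : ψ 0 ∈ (chartAt E (φ 0)).source := h0 ▸ hφc
    have : taylor1 (chartAt E (φ 0) ∘ φ) = taylor1 (chartAt E (φ 0) ∘ ψ) := by
      simp only [taylor1, Function.comp_apply, h1]
      rw [h0]
    rw [taylor1_chart_change hc he φ hφc hφ, taylor1_chart_change hc he ψ hψc hψ, this]
  · intro h
    have h0 : φ 0 = ψ 0 := e.injOn hφ hψ (congrArg Prod.fst h)
    have hψc : ψ 0 ∈ (chartAt E (φ 0)).source := h0 ▸ hφc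
    have h2 : taylor1 (chartAt E (φ 0) ∘ φ) = taylor1 (chartAt E (φ 0) ∘ ψ) := by
      rw [taylor1_chart_change he hc φ hφ hφc, taylor1_chart_change he hc ψ hψ hψc, h]
    exact Quotient.sound ⟨h0, congrArg Prod.snd h2⟩

/-- On a Hausdorff manifold, two smooth maps have the same `1`-jet if and only if their compositions
with every smooth real function have the same value and the same first derivatives at the origin. -/
theorem j1_eq_iff_forall_smooth [FiniteDimensional ℝ E] [T2Space M]
    {φ ψ : C^∞⟮𝓘(ℝ, V), V; 𝓘(ℝ, E), M⟯} :
    j1 φ = j1 ψ ↔ ∀ f : M → ℝ, ContMDiff 𝓘(ℝ, E) 𝓘(ℝ, ℝ) ∞ f →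
      f (φ 0) = f (ψ 0) ∧ fderiv ℝ (f ∘ φ) 0 = fderiv ℝ (f ∘ ψ) 0 := by
  have hc := chart_mem_atlas E (φ 0)
  have hφc := mem_chart_source E (φ 0)
  constructor
  · intro h f hf
    have h0 : φ 0 = ψ 0 := (Quotient.exact h).1
    have hψc : ψ 0 ∈ (chartAt E (φ 0)).source := h0 ▸ hφc
    have ht := (j1_eq_iff hc hφc hψc).1 h
    have key : ∀ χ : C^∞⟮𝓘(ℝ, V), V; 𝓘(ℝ, E), M⟯, χ 0 = φ 0 →
        taylor1 (f ∘ χ) = push1 (f ∘ (chartAt E (φ 0)).symm) (taylor1 (chartAt E (φ 0) ∘ χ)) := by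
      intro χ hχ
      have hχc : χ 0 ∈ (chartAt E (φ 0)).source := hχ ▸ hφc
      have hev : f ∘ χ =ᶠ[𝓝 0] (f ∘ (chartAt E (φ 0)).symm) ∘ (chartAt E (φ 0) ∘ χ) := by
        have : ∀ᶠ u in 𝓝 (0 : V), χ u ∈ (chartAt E (φ 0)).source :=
          χ.contMDiff.continuous.continuousAt.eventually
            ((chartAt E (φ 0)).open_source.mem_nhds hχc)
        filter_upwards [this] with u hu
        simp [hu]
      refine hev.taylor1_eq.trans (taylor1_comp ?_ (contDiffAt_chart_comp hc χ hχc))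
      rw [← contMDiffAt_iff_contDiffAt]
      exact hf.contMDiffAt.comp _ (contMDiffAt_symm_of_mem_maximalAtlas
        (IsManifold.subset_maximalAtlas hc) ((chartAt E (φ 0)).map_source hχc))
    have h1 : taylor1 (f ∘ φ) = taylor1 (f ∘ ψ) := by
      rw [key φ rfl, key ψ h0.symm, ht]
    exact ⟨congrArg Prod.fst h1, congrArg Prod.snd h1⟩
  · intro h
    have h0 : φ 0 = ψ 0 := by
      by_contra hne
      obtain ⟨b, -, hb⟩ := (SmoothBumpFunction.nhds_basis_support (I := 𝓘(ℝ, E))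
        (c := φ 0) (s := {ψ 0}ᶜ) (isOpen_compl_singleton.mem_nhds hne)).mem_iff.1
          (isOpen_compl_singleton.mem_nhds hne)
      have h1 := (h b b.contMDiff).1
      have h2 : b (ψ 0) = 0 := by
        by_contra h3
        exact hb (Function.mem_support.2 h3) rfl
      rw [b.eq_one, h2] at h1
      exact one_ne_zero h1
    refine Quotient.sound ⟨h0, ?_⟩
    obtain ⟨b, -, -⟩ := (SmoothBumpFunction.nhds_basis_support (I := 𝓘(ℝ, E))
      (c := φ 0) (s := Set.univ) Filter.univ_mem).mem_iff.1 Filter.univ_mem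
    have key : ∀ (L : E →L[ℝ] ℝ) (χ : C^∞⟮𝓘(ℝ, V), V; 𝓘(ℝ, E), M⟯), χ 0 = φ 0 →
        fderiv ℝ ((fun x => b x • L (chartAt E (φ 0) x)) ∘ χ) 0 =
          L.comp (fderiv ℝ (chartAt E (φ 0) ∘ χ) 0) := by
      intro L χ hχ
      have hev : (fun x => b x • L (chartAt E (φ 0) x)) ∘ χ =ᶠ[𝓝 0]
          L ∘ (chartAt E (φ 0) ∘ χ) := by
        have : ∀ᶠ u in 𝓝 (0 : V), b (χ u) = 1 :=
          χ.contMDiff.continuous.continuousAt.eventually (by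
            rw [hχ]
            exact b.eventuallyEq_one)
        filter_upwards [this] with u hu
        simp [hu]
      rw [hev.fderiv_eq]
      exact (L.hasFDerivAt.comp (0 : V) ((contDiffAt_chart_comp hc χ
        (hχ ▸ hφc)).differentiableAt (by simp)).hasFDerivAt).fderiv
    ext v
    refine (SeparatingDual.eq_iff_forall_dual_eq (R := ℝ)).2 fun L => ?_
    have hsm : ContMDiff 𝓘(ℝ, E) 𝓘(ℝ, ℝ) ∞ (fun x => b x • L (chartAt E (φ 0) x)) := by
      refine b.contMDiff_smul ?_
      exact L.contMDiff.comp_contMDiffOn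
        (contMDiffOn_of_mem_maximalAtlas (IsManifold.subset_maximalAtlas hc))
    have h2 := (h _ hsm).2
    rw [key L φ rfl, key L ψ h0.symm] at h2
    exact congrArg (fun T : V →L[ℝ] ℝ => T v) h2

variable [FiniteDimensional ℝ V]

/-- The chart of the manifold of `1`-jets induced by a chart `e` of `M`:
`j¹φ ↦ (e(φ(0)), D(e ∘ φ)(0))`, see `chart_j1`. -/
def chart (e : OpenPartialHomeomorph M E) (he : e ∈ atlas E M) :
    PartialEquiv (Jet1 E V M) (Model1 V E) where
  toFun z := taylor1 (e ∘ z.rep)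
  invFun y := j1 (@Classical.epsilon _ ⟨ContMDiffMap.const (e.symm y.1)⟩
    fun φ : C^∞⟮𝓘(ℝ, V), V; 𝓘(ℝ, E), M⟯ => φ 0 ∈ e.source ∧ taylor1 (e ∘ φ) = y)
  source := {z | z.base ∈ e.source}
  target := {y | y.1 ∈ e.target}
  map_source' := by
    intro z hz
    have hz' : z.rep 0 ∈ e.source := by simpa using hz
    exact e.map_source hz'
  map_target' := by
    intro y hy
    exact (Classical.epsilon_spec (exists_taylor1 he hy)).1
  left_inv' := by
    intro z hz
    have hz' : z.rep 0 ∈ e.source := by simpa using hz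
    have h := Classical.epsilon_spec (exists_taylor1 (V := V) he
      (y := taylor1 (e ∘ z.rep)) (e.map_source hz'))
    rw [← j1_rep z, j1_rep z]
    exact ((j1_eq_iff he h.1 hz').2 h.2).trans (j1_rep z)
  right_inv' := by
    intro y hy
    have h := Classical.epsilon_spec (exists_taylor1 (V := V) he hy)
    have h' : (j1 (@Classical.epsilon _ ⟨ContMDiffMap.const (e.symm y.1)⟩
      fun φ : C^∞⟮𝓘(ℝ, V), V; 𝓘(ℝ, E), M⟯ => φ 0 ∈ e.source ∧ taylor1 (e ∘ φ) = y)).rep 0 ∈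
        e.source := by simpa using h.1
    exact ((j1_eq_iff he h' h.1).1 (j1_rep _)).trans h.2

theorem chart_j1 {e : OpenPartialHomeomorph M E} (he : e ∈ atlas E M)
    {φ : C^∞⟮𝓘(ℝ, V), V; 𝓘(ℝ, E), M⟯} (hφ : φ 0 ∈ e.source) :
    chart e he (j1 φ) = taylor1 (e ∘ φ) := by
  have h : (j1 φ).rep 0 ∈ e.source := by simpa using hφ
  exact (j1_eq_iff he h hφ).1 (j1_rep _)

theorem base_chart_symm {e : OpenPartialHomeomorph M E} (he : e ∈ atlas E M)
    {y : Model1 V E} (hy : y.1 ∈ e.target) :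
    ((chart (V := V) e he).symm y).base = e.symm y.1 := by
  have h := Classical.epsilon_spec (exists_taylor1 (V := V) he hy)
  refine e.injOn h.1 (e.map_target hy) ?_
  rw [e.right_inv hy]
  exact congrArg Prod.fst h.2

theorem chart_trans_source {e e' : OpenPartialHomeomorph M E} (he : e ∈ atlas E M)
    (he' : e' ∈ atlas E M) :
    ((chart (V := V) e he).symm.trans (chart e' he')).source =
      Prod.fst ⁻¹' (e.symm ≫ₕ e').source := by
  ext y
  have key : y.1 ∈ e.target →
      (((chart (V := V) e he).symm y).base ∈ e'.source ↔ e.symm y.1 ∈ e'.source) :=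
    fun hy => by rw [base_chart_symm he hy]
  simpa [PartialEquiv.trans_source, chart] using key

theorem chart_trans_eqOn {e e' : OpenPartialHomeomorph M E} (he : e ∈ atlas E M)
    (he' : e' ∈ atlas E M) :
    Set.EqOn ((chart (V := V) e he).symm.trans (chart e' he')) (push1 (e' ∘ e.symm))
      (Prod.fst ⁻¹' (e.symm ≫ₕ e').source) := by
  intro y hy
  have hy1 : y.1 ∈ e.target := by
    have h : y.1 ∈ (e.symm ≫ₕ e').source := hy
    simpa using h.1
  have hy2 : e.symm y.1 ∈ e'.source := by
    have h : y.1 ∈ (e.symm ≫ₕ e').source := hy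
    simpa using h.2
  have hb := base_chart_symm (V := V) he hy1
  set z := (chart (V := V) e he).symm y with hz
  have hz1 : z.rep 0 ∈ e.source := by
    rw [rep_zero, hb]
    exact e.map_target hy1
  have hz2 : z.rep 0 ∈ e'.source := by
    rw [rep_zero, hb]
    exact hy2
  have h1 : taylor1 (e ∘ z.rep) = y := (chart (V := V) e he).right_inv hy1
  change taylor1 (e' ∘ z.rep) = _
  rw [taylor1_chart_change he he' z.rep hz1 hz2, h1]

theorem contDiffOn_chart_trans {e e' : OpenPartialHomeomorph M E} (he : e ∈ atlas E M)
    (he' : e' ∈ atlas E M) :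
    ContDiffOn ℝ ∞ ((chart (V := V) e he).symm.trans (chart e' he'))
      ((chart (V := V) e he).symm.trans (chart e' he')).source := by
  rw [chart_trans_source]
  exact (contDiffOn_push1 (e.symm ≫ₕ e').open_source (contDiffOn_transition he he')).congr
    (chart_trans_eqOn he he')

variable (E V M) in
/-- The charts `chart e`, for `e` in the atlas of `M`, form an atlas. -/
def core : ChartedSpaceCore (Model1 V E) (Jet1 E V M) where
  atlas := {c | ∃ (e : OpenPartialHomeomorph M E) (he : e ∈ atlas E M), c = chart e he}
  chartAt z := chart (chartAt E z.base) (chart_mem_atlas E z.base)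
  mem_chart_source z := mem_chart_source E z.base
  chart_mem_atlas z := ⟨_, _, rfl⟩
  open_source := by
    rintro _ _ ⟨e, he, rfl⟩ ⟨e', he', rfl⟩
    rw [chart_trans_source]
    exact (e.symm ≫ₕ e').open_source.preimage continuous_fst
  continuousOn_toFun := by
    rintro _ _ ⟨e, he, rfl⟩ ⟨e', he', rfl⟩
    exact (contDiffOn_chart_trans he he').continuousOn

instance : TopologicalSpace (Jet1 E V M) := (core E V M).toTopologicalSpace

instance : ChartedSpace (Model1 V E) (Jet1 E V M) := (core E V M).toChartedSpace

instance : IsManifold 𝓘(ℝ, Model1 V E) ∞ (Jet1 E V M) := by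
  refine isManifold_of_contDiffOn _ _ _ ?_
  intro c c' hc hc'
  obtain ⟨d, ⟨e, he, rfl⟩, rfl⟩ := Set.mem_iUnion₂.1 hc
  obtain ⟨d', ⟨e', he', rfl⟩, rfl⟩ := Set.mem_iUnion₂.1 hc'
  refine (contDiffOn_chart_trans (V := V) he he').mono ?_
  intro y hy
  exact hy.1

theorem chartAt_apply (z : Jet1 E V M) (φ : C^∞⟮𝓘(ℝ, V), V; 𝓘(ℝ, E), M⟯)
    (h : φ 0 ∈ (chartAt E z.base).source) :
    chartAt (Model1 V E) z (j1 φ) = taylor1 (chartAt E z.base ∘ φ) :=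
  chart_j1 (chart_mem_atlas E z.base) h

theorem mem_chartAt_source (z w : Jet1 E V M) :
    w ∈ (chartAt (Model1 V E) z).source ↔ w.base ∈ (chartAt E z.base).source := Iff.rfl

end Jet1

end Jet1

/-! ### The manifold of 2-jets -/

section Jet2

variable (E : Type*) [NormedAddCommGroup E] [NormedSpace ℝ E]
  (V : Type*) [NormedAddCommGroup V] [NormedSpace ℝ V]
  (M : Type*) [TopologicalSpace M] [ChartedSpace E M]

/-- Two smooth maps `V → M` are equivalent if they have the same value at the origin and, in a chart
around that value, the same first and second partial derivatives at the origin. The chart used is the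
preferred one; by `Jet2.j2_eq_iff` every chart of the atlas gives the same relation. -/
def jet2Setoid : Setoid C^∞⟮𝓘(ℝ, V), V; 𝓘(ℝ, E), M⟯ where
  r φ ψ := φ 0 = ψ 0 ∧
    fderiv ℝ (chartAt E (φ 0) ∘ φ) 0 = fderiv ℝ (chartAt E (φ 0) ∘ ψ) 0 ∧
    fderiv ℝ (fderiv ℝ (chartAt E (φ 0) ∘ φ)) 0 = fderiv ℝ (fderiv ℝ (chartAt E (φ 0) ∘ ψ)) 0
  iseqv := by
    refine ⟨fun φ => ⟨rfl, rfl, rfl⟩, ?_, ?_⟩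
    · rintro φ ψ ⟨h0, h1, h2⟩
      exact ⟨h0.symm, by rw [← h0, h1], by rw [← h0, h2]⟩
    · rintro φ ψ χ ⟨h0, h1, h2⟩ ⟨h0', h1', h2'⟩
      exact ⟨h0.trans h0', by rw [h1, h0, h1'], by rw [h2, h0, h2']⟩

/-- The set of `2`-jets at the origin of smooth maps `V → M`, for a manifold `M` modelled on `E`.
For `V = ℝ²ᵖ` this is `J²₂ₚ M`. -/
def Jet2 : Type _ := Quotient (jet2Setoid E V M)

variable {E V M}

/-- The `2`-jet `j²φ` of a smooth map `φ : V → M` at the origin. -/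
def j2 (φ : C^∞⟮𝓘(ℝ, V), V; 𝓘(ℝ, E), M⟯) : Jet2 E V M := Quotient.mk (jet2Setoid E V M) φ

namespace Jet2

/-- The bundle projection `j²φ ↦ φ(0)`. -/
def base : Jet2 E V M → M := Quotient.lift (fun φ => φ 0) fun _ _ h => h.1

@[simp] theorem base_j2 (φ : C^∞⟮𝓘(ℝ, V), V; 𝓘(ℝ, E), M⟯) : base (j2 φ) = φ 0 := rfl

/-- A smooth map representing a given jet. -/
def rep (z : Jet2 E V M) : C^∞⟮𝓘(ℝ, V), V; 𝓘(ℝ, E), M⟯ := Quotient.out z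

@[simp] theorem j2_rep (z : Jet2 E V M) : j2 z.rep = z := Quotient.out_eq z

@[simp] theorem rep_zero (z : Jet2 E V M) : z.rep 0 = z.base := by
  conv_rhs => rw [← j2_rep z]
  rfl

variable [IsManifold 𝓘(ℝ, E) ∞ M]

/-- Equality of `2`-jets can be tested in any chart. -/
theorem j2_eq_iff {e : OpenPartialHomeomorph M E} (he : e ∈ atlas E M)
    {φ ψ : C^∞⟮𝓘(ℝ, V), V; 𝓘(ℝ, E), M⟯} (hφ : φ 0 ∈ e.source) (hψ : ψ 0 ∈ e.source) :
    j2 φ = j2 ψ ↔ taylor2 (e ∘ φ) = taylor2 (e ∘ ψ) := by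
  have hc := chart_mem_atlas E (φ 0)
  have hφc := mem_chart_source E (φ 0)
  constructor
  · intro h
    obtain ⟨h0, h1, h2⟩ := Quotient.exact h
    have hψc : ψ 0 ∈ (chartAt E (φ 0)).source := h0 ▸ hφc
    have : taylor2 (chartAt E (φ 0) ∘ φ) = taylor2 (chartAt E (φ 0) ∘ ψ) := by
      simp only [taylor2, Function.comp_apply, h1, h2]
      rw [h0]
    rw [taylor2_chart_change hc he φ hφc hφ, taylor2_chart_change hc he ψ hψc hψ, this]
  · intro h
    have h0 : φ 0 = ψ 0 := e.injOn hφ hψ (congrArg Prod.fst h)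
    have hψc : ψ 0 ∈ (chartAt E (φ 0)).source := h0 ▸ hφc
    have h2 : taylor2 (chartAt E (φ 0) ∘ φ) = taylor2 (chartAt E (φ 0) ∘ ψ) := by
      rw [taylor2_chart_change he hc φ hφ hφc, taylor2_chart_change he hc ψ hψ hψc, h]
    refine Quotient.sound ⟨h0, congrArg (fun y => y.2.1) h2, ?_⟩
    have h3 : ((taylor2 (chartAt E (φ 0) ∘ φ)).2.2 : V →L[ℝ] V →L[ℝ] E) =
        (taylor2 (chartAt E (φ 0) ∘ ψ)).2.2 := by rw [h2]
    rwa [coe_taylor2 (contDiffAt_chart_comp hc φ hφc),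
      coe_taylor2 (contDiffAt_chart_comp hc ψ hψc)] at h3

variable [FiniteDimensional ℝ V]

/-- The chart of the manifold of `2`-jets induced by a chart `e` of `M`:
`j²φ ↦ (e(φ(0)), D(e ∘ φ)(0), D²(e ∘ φ)(0))`, see `chart_j2`. -/
def chart (e : OpenPartialHomeomorph M E) (he : e ∈ atlas E M) :
    PartialEquiv (Jet2 E V M) (Model2 V E) where
  toFun z := taylor2 (e ∘ z.rep)
  invFun y := j2 (@Classical.epsilon _ ⟨ContMDiffMap.const (e.symm y.1)⟩
    fun φ : C^∞⟮𝓘(ℝ, V), V; 𝓘(ℝ, E), M⟯ => φ 0 ∈ e.source ∧ taylor2 (e ∘ φ) = y)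
  source := {z | z.base ∈ e.source}
  target := {y | y.1 ∈ e.target}
  map_source' := by
    intro z hz
    have hz' : z.rep 0 ∈ e.source := by simpa using hz
    exact e.map_source hz'
  map_target' := by
    intro y hy
    exact (Classical.epsilon_spec (exists_taylor2 he hy)).1
  left_inv' := by
    intro z hz
    have hz' : z.rep 0 ∈ e.source := by simpa using hz
    have h := Classical.epsilon_spec (exists_taylor2 (V := V) he
      (y := taylor2 (e ∘ z.rep)) (e.map_source hz'))
    rw [← j2_rep z, j2_rep z]
    exact ((j2_eq_iff he h.1 hz').2 h.2).trans (j2_rep z)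
  right_inv' := by
    intro y hy
    have h := Classical.epsilon_spec (exists_taylor2 (V := V) he hy)
    have h' : (j2 (@Classical.epsilon _ ⟨ContMDiffMap.const (e.symm y.1)⟩
      fun φ : C^∞⟮𝓘(ℝ, V), V; 𝓘(ℝ, E), M⟯ => φ 0 ∈ e.source ∧ taylor2 (e ∘ φ) = y)).rep 0 ∈
        e.source := by simpa using h.1
    exact ((j2_eq_iff he h' h.1).1 (j2_rep _)).trans h.2

theorem chart_j2 {e : OpenPartialHomeomorph M E} (he : e ∈ atlas E M)
    {φ : C^∞⟮𝓘(ℝ, V), V; 𝓘(ℝ, E), M⟯} (hφ : φ 0 ∈ e.source) :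
    chart e he (j2 φ) = taylor2 (e ∘ φ) := by
  have h : (j2 φ).rep 0 ∈ e.source := by simpa using hφ
  exact (j2_eq_iff he h hφ).1 (j2_rep _)

theorem base_chart_symm {e : OpenPartialHomeomorph M E} (he : e ∈ atlas E M)
    {y : Model2 V E} (hy : y.1 ∈ e.target) :
    ((chart (V := V) e he).symm y).base = e.symm y.1 := by
  have h := Classical.epsilon_spec (exists_taylor2 (V := V) he hy)
  refine e.injOn h.1 (e.map_target hy) ?_
  rw [e.right_inv hy]
  exact congrArg Prod.fst h.2

theorem chart_trans_source {e e' : OpenPartialHomeomorph M E} (he : e ∈ atlas E M)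
    (he' : e' ∈ atlas E M) :
    ((chart (V := V) e he).symm.trans (chart e' he')).source =
      Prod.fst ⁻¹' (e.symm ≫ₕ e').source := by
  ext y
  have key : y.1 ∈ e.target →
      (((chart (V := V) e he).symm y).base ∈ e'.source ↔ e.symm y.1 ∈ e'.source) :=
    fun hy => by rw [base_chart_symm he hy]
  simpa [PartialEquiv.trans_source, chart] using key

theorem chart_trans_eqOn {e e' : OpenPartialHomeomorph M E} (he : e ∈ atlas E M)
    (he' : e' ∈ atlas E M) :
    Set.EqOn ((chart (V := V) e he).symm.trans (chart e' he')) (push2 (e' ∘ e.symm))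
      (Prod.fst ⁻¹' (e.symm ≫ₕ e').source) := by
  intro y hy
  have hy1 : y.1 ∈ e.target := by
    have h : y.1 ∈ (e.symm ≫ₕ e').source := hy
    simpa using h.1
  have hy2 : e.symm y.1 ∈ e'.source := by
    have h : y.1 ∈ (e.symm ≫ₕ e').source := hy
    simpa using h.2
  have hb := base_chart_symm (V := V) he hy1
  set z := (chart (V := V) e he).symm y with hz
  have hz1 : z.rep 0 ∈ e.source := by
    rw [rep_zero, hb]
    exact e.map_target hy1
  have hz2 : z.rep 0 ∈ e'.source := by
    rw [rep_zero, hb]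
    exact hy2
  have h1 : taylor2 (e ∘ z.rep) = y := (chart (V := V) e he).right_inv hy1
  change taylor2 (e' ∘ z.rep) = _
  rw [taylor2_chart_change he he' z.rep hz1 hz2, h1]

theorem contDiffOn_chart_trans {e e' : OpenPartialHomeomorph M E} (he : e ∈ atlas E M)
    (he' : e' ∈ atlas E M) :
    ContDiffOn ℝ ∞ ((chart (V := V) e he).symm.trans (chart e' he'))
      ((chart (V := V) e he).symm.trans (chart e' he')).source := by
  rw [chart_trans_source]
  exact (contDiffOn_push2 (e.symm ≫ₕ e').open_source (contDiffOn_transition he he')).congr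
    (chart_trans_eqOn he he')

variable (E V M) in
/-- The charts `chart e`, for `e` in the atlas of `M`, form an atlas. -/
def core : ChartedSpaceCore (Model2 V E) (Jet2 E V M) where
  atlas := {c | ∃ (e : OpenPartialHomeomorph M E) (he : e ∈ atlas E M), c = chart e he}
  chartAt z := chart (chartAt E z.base) (chart_mem_atlas E z.base)
  mem_chart_source z := mem_chart_source E z.base
  chart_mem_atlas z := ⟨_, _, rfl⟩
  open_source := by
    rintro _ _ ⟨e, he, rfl⟩ ⟨e', he', rfl⟩
    rw [chart_trans_source]
    exact (e.symm ≫ₕ e').open_source.preimage continuous_fst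
  continuousOn_toFun := by
    rintro _ _ ⟨e, he, rfl⟩ ⟨e', he', rfl⟩
    exact (contDiffOn_chart_trans he he').continuousOn

instance : TopologicalSpace (Jet2 E V M) := (core E V M).toTopologicalSpace

instance : ChartedSpace (Model2 V E) (Jet2 E V M) := (core E V M).toChartedSpace

instance : IsManifold 𝓘(ℝ, Model2 V E) ∞ (Jet2 E V M) := by
  refine isManifold_of_contDiffOn _ _ _ ?_
  intro c c' hc hc'
  obtain ⟨d, ⟨e, he, rfl⟩, rfl⟩ := Set.mem_iUnion₂.1 hc
  obtain ⟨d', ⟨e', he', rfl⟩, rfl⟩ := Set.mem_iUnion₂.1 hc'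
  refine (contDiffOn_chart_trans (V := V) he he').mono ?_
  intro y hy
  exact hy.1

theorem chartAt_apply (z : Jet2 E V M) (φ : C^∞⟮𝓘(ℝ, V), V; 𝓘(ℝ, E), M⟯)
    (h : φ 0 ∈ (chartAt E z.base).source) :
    chartAt (Model2 V E) z (j2 φ) = taylor2 (chartAt E z.base ∘ φ) :=
  chart_j2 (chart_mem_atlas E z.base) h

theorem mem_chartAt_source (z w : Jet2 E V M) :
    w ∈ (chartAt (Model2 V E) z).source ↔ w.base ∈ (chartAt E z.base).source := Iff.rfl

end Jet2

end Jet2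

/-! ### The map `Λ` from `2`-jets to iterated `1`-jets -/

section Double

variable {E : Type*} [NormedAddCommGroup E] [NormedSpace ℝ E]
  {V : Type*} [NormedAddCommGroup V] [NormedSpace ℝ V]
  {M : Type*} [TopologicalSpace M] [ChartedSpace E M]

/-- The flip `(u, w) ↦ (w, u)` of `V × V`. -/
def flipMap : C^∞⟮𝓘(ℝ, V × V), V × V; 𝓘(ℝ, V × V), V × V⟯ :=
  ⟨fun x => (x.2, x.1), (contDiff_snd.prodMk contDiff_fst).contMDiff⟩

/-- For a smooth map `φ : V × V → M` and `u : V`, the smooth map `φᵤ : w ↦ φ(u, w)`. -/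
def slice (φ : C^∞⟮𝓘(ℝ, V × V), V × V; 𝓘(ℝ, E), M⟯) (u : V) : C^∞⟮𝓘(ℝ, V), V; 𝓘(ℝ, E), M⟯ :=
  ⟨fun w => φ (u, w), φ.contMDiff.comp (contDiff_prodMk_right u).contMDiff⟩

variable [IsManifold 𝓘(ℝ, E) ∞ M]

theorem taylor1_slice {e : OpenPartialHomeomorph M E} (he : e ∈ atlas E M)
    (φ : C^∞⟮𝓘(ℝ, V × V), V × V; 𝓘(ℝ, E), M⟯) {u : V} (hu : φ (u, 0) ∈ e.source) :
    taylor1 (e ∘ slice φ u) =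
      (e (φ (u, 0)), (fderiv ℝ (e ∘ φ) (u, 0)).comp (ContinuousLinearMap.inr ℝ V V)) := by
  have h : HasFDerivAt (e ∘ φ) (fderiv ℝ (e ∘ φ) (u, 0)) (u, 0) :=
    ((contDiffAt_chart_comp he φ hu).differentiableAt (by simp)).hasFDerivAt
  exact Prod.ext rfl (h.comp (0 : V) (hasFDerivAt_prodMk_right u 0)).fderiv

variable [FiniteDimensional ℝ V]

/-- In charts, `u ↦ j¹(φᵤ)` is `u ↦ (φ(u, 0), D_w φ(u, 0))`. -/
theorem chartAt_comp_slice (z : Jet1 E V M) (φ : C^∞⟮𝓘(ℝ, V × V), V × V; 𝓘(ℝ, E), M⟯) {u : V}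
    (hu : φ (u, 0) ∈ (chartAt E z.base).source) :
    (chartAt (Model1 V E) z ∘ fun u => j1 (slice φ u)) =ᶠ[𝓝 u] fun u =>
      ((chartAt E z.base ∘ φ) (u, 0),
        (fderiv ℝ (chartAt E z.base ∘ φ) (u, 0)).comp (ContinuousLinearMap.inr ℝ V V)) := by
  have hc : ContinuousAt (fun u : V => φ (u, 0)) u :=
    (φ.contMDiff.continuous.comp (Continuous.prodMk_left (0 : V))).continuousAt
  filter_upwards [hc.eventually ((chartAt E z.base).open_source.mem_nhds hu)] with v hv
  exact (Jet1.chartAt_apply z (slice φ v) hv).trans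
    (taylor1_slice (chart_mem_atlas E z.base) φ hv)

theorem contMDiff_slice (φ : C^∞⟮𝓘(ℝ, V × V), V × V; 𝓘(ℝ, E), M⟯) :
    ContMDiff 𝓘(ℝ, V) 𝓘(ℝ, Model1 V E) ∞ (fun u => j1 (slice φ u)) := by
  intro u
  have hu : φ (u, 0) ∈ (chartAt E (j1 (slice φ u)).base).source :=
    mem_chart_source E (φ (u, 0))
  have hev := chartAt_comp_slice (j1 (slice φ u)) φ hu
  have hf := contDiffAt_chart_comp (chart_mem_atlas E (j1 (slice φ u)).base) φ hu
  have hi : ContDiffAt ℝ ∞ (fun u : V => (u, (0 : V))) u :=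
    (contDiff_prodMk_left (0 : V)).contDiffAt
  have hsm : ContDiffAt ℝ ∞
      (chartAt (Model1 V E) (j1 (slice φ u)) ∘ fun u => j1 (slice φ u)) u := by
    refine ContDiffAt.congr_of_eventuallyEq ?_ hev
    have h1 := ContDiffAt.comp (f := fun u : V => (u, (0 : V))) u hf hi
    have h2 := ContDiffAt.comp (f := fun u : V => (u, (0 : V))) u
      (hf.fderiv_right (m := ∞) (by simp)) hi
    exact h1.prodMk (h2.clm_comp contDiffAt_const)
  have hpre : (fun u => j1 (slice φ u)) ⁻¹' (chartAt (Model1 V E) (j1 (slice φ u))).source ∈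
      𝓝 u := by
    have hc : ContinuousAt (fun u : V => φ (u, 0)) u :=
      (φ.contMDiff.continuous.comp (Continuous.prodMk_left (0 : V))).continuousAt
    exact hc.preimage_mem_nhds ((chartAt E _).open_source.mem_nhds hu)
  rw [contMDiffAt_iff_target]
  refine ⟨?_, ?_⟩
  · rw [(chartAt (Model1 V E) (j1 (slice φ u))).continuousAt_iff_continuousAt_comp_left hpre]
    exact hsm.continuousAt
  · rw [contMDiffAt_iff_contDiffAt]
    simpa using hsm

/-- For a smooth map `φ : V × V → M`, the smooth map `Φ : V → J¹ M`, `Φ(u) = j¹(φᵤ)`. -/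
def doubleMap (φ : C^∞⟮𝓘(ℝ, V × V), V × V; 𝓘(ℝ, E), M⟯) :
    C^∞⟮𝓘(ℝ, V), V; 𝓘(ℝ, Model1 V E), Jet1 E V M⟯ :=
  ⟨fun u => j1 (slice φ u), contMDiff_slice φ⟩

theorem fderiv_chartAt_doubleMap (z : Jet1 E V M) (φ : C^∞⟮𝓘(ℝ, V × V), V × V; 𝓘(ℝ, E), M⟯)
    (h : φ 0 ∈ (chartAt E z.base).source) :
    fderiv ℝ (chartAt (Model1 V E) z ∘ doubleMap φ) 0 =
      ((fderiv ℝ (chartAt E z.base ∘ φ) 0).comp (ContinuousLinearMap.inl ℝ V V)).prod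
        (((ContinuousLinearMap.compL ℝ V (V × V) E).flip (ContinuousLinearMap.inr ℝ V V)).comp
          ((fderiv ℝ (fderiv ℝ (chartAt E z.base ∘ φ)) 0).comp
            (ContinuousLinearMap.inl ℝ V V))) := by
  have hf := contDiffAt_chart_comp (chart_mem_atlas E z.base) φ h
  have hi : HasFDerivAt (fun u : V => (u, (0 : V))) (ContinuousLinearMap.inl ℝ V V) 0 :=
    hasFDerivAt_prodMk_left 0 0
  have h1 : HasFDerivAt (chartAt E z.base ∘ φ) (fderiv ℝ (chartAt E z.base ∘ φ) 0) ((0 : V), 0) :=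
    (hf.differentiableAt (by simp)).hasFDerivAt
  have h2 : HasFDerivAt (fderiv ℝ (chartAt E z.base ∘ φ))
      (fderiv ℝ (fderiv ℝ (chartAt E z.base ∘ φ)) 0) ((0 : V), 0) :=
    ((hf.fderiv_right (m := ∞) (by simp)).differentiableAt (by simp)).hasFDerivAt
  have h1' := HasFDerivAt.comp (f := fun u : V => (u, (0 : V))) (0 : V) h1 hi
  have h2' := HasFDerivAt.comp (f := fun u : V => (u, (0 : V))) (0 : V) h2 hi
  have h3 := ((ContinuousLinearMap.compL ℝ V (V × V) E).flip
    (ContinuousLinearMap.inr ℝ V V)).hasFDerivAt.comp (0 : V) h2'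
  have h4 := (h1'.prodMk h3).fderiv
  exact (chartAt_comp_slice z φ h).fderiv_eq.trans h4

/-- The map `Λ : J² M → J¹(J¹ M)`, `Λ(j²φ) = j¹Φ` with `Φ(u) = j¹(φᵤ)` and `φᵤ(w) = φ(u, w)`. -/
def Lambda : Jet2 E (V × V) M → Jet1 (Model1 V E) V (Jet1 E V M) :=
  Quotient.lift (fun φ => j1 (doubleMap φ)) (by
    rintro φ ψ ⟨h0, h1, h2⟩
    have hφ : φ 0 ∈ (chartAt E (φ 0)).source := mem_chart_source E (φ 0)
    have hψ : ψ 0 ∈ (chartAt E (φ 0)).source := h0 ▸ hφ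
    refine Quotient.sound ⟨?_, ?_⟩
    · refine (Jet1.j1_eq_iff (φ := slice φ 0) (ψ := slice ψ 0) (chart_mem_atlas E (φ 0)) hφ hψ).2 ?_
      refine (taylor1_slice (chart_mem_atlas E (φ 0)) φ hφ).trans
        (Eq.trans ?_ (taylor1_slice (chart_mem_atlas E (φ 0)) ψ hψ).symm)
      exact Prod.ext (congrArg (fun x => chartAt E (φ 0) x) h0) (congrArg (fun L => ContinuousLinearMap.comp L _) h1)
    · have e1 := fderiv_chartAt_doubleMap (doubleMap φ 0) φ hφ
      have e2 := fderiv_chartAt_doubleMap (doubleMap φ 0) ψ hψ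
      have hb : (doubleMap φ 0).base = φ 0 := rfl
      rw [hb, h1, h2] at e1
      rw [hb] at e2
      exact e1.trans e2.symm)

@[simp] theorem Lambda_j2 (φ : C^∞⟮𝓘(ℝ, V × V), V × V; 𝓘(ℝ, E), M⟯) :
    Lambda (j2 φ) = j1 (doubleMap φ) := rfl

end Double

/-! ### The manifolds `J¹ₚ M`, `J²₂ₚ M` and `J¹ₚ(J¹ₚ M)` -/

section Euclidean

variable (p : ℕ) (E : Type*) [NormedAddCommGroup E] [NormedSpace ℝ E]

/-- The model space of `J¹ₚ M`. -/
abbrev J1Model := Model1 (EuclideanSpace ℝ (Fin p)) E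

/-- The model space of `J²₂ₚ M`. -/
abbrev J2Model := Model2 (EuclideanSpace ℝ (Fin p) × EuclideanSpace ℝ (Fin p)) E

/-- The model space of `J¹ₚ(J¹ₚ M)`. -/
abbrev JJModel := J1Model p (J1Model p E)

variable (M : Type*) [TopologicalSpace M] [ChartedSpace E M]

/-- `J¹ₚ M`: the `1`-jets at the origin of smooth maps `ℝᵖ → M`. -/
abbrev J1 := Jet1 E (EuclideanSpace ℝ (Fin p)) M

/-- `J²₂ₚ M`: the `2`-jets at the origin of smooth maps `ℝ²ᵖ = ℝᵖ × ℝᵖ → M`. -/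
abbrev J2 := Jet2 E (EuclideanSpace ℝ (Fin p) × EuclideanSpace ℝ (Fin p)) M

/-- `J¹ₚ(J¹ₚ M)`: the `1`-jets at the origin of smooth maps from `ℝᵖ` to the manifold `J¹ₚ M`. -/
abbrev JJ [IsManifold 𝓘(ℝ, E) ∞ M] := J1 p (J1Model p E) (J1 p E M)

end Euclidean

end JetBundle

end

open JetBundle

open scoped Manifold ContDiff Topology

noncomputable section

/-! ### Smoothness tested in preferred charts. -/

namespace JetBundle

/-! In a chart of $M$ a 2-jet of a map of $(u,w)$ is a triple $(x, A, B)$ with $A = (A_u, A_w)$ and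
$B$ symmetric, made of the blocks $B_{uu}$, $B_{uw}$, $B_{ww}$. Precomposition with the flip
exchanges $A_u$ with $A_w$ and $B_{uu}$ with $B_{ww}$, and it replaces $B_{uw}$ by its transpose,
because $B$ is symmetric. This is a linear map in coordinates, so $\hat\ell$ is smooth; being its
own inverse, it is a diffeomorphism.

In the same coordinates $\Lambda$ is $(x, A, B) \mapsto ((x, A_w), (A_u, B_{uw}))$: it forgets
$B_{uu}$ and $B_{ww}$ and nothing else. Two facts follow. First, $\Lambda$ is surjective
(`Lambda_surjective`), since the missing blocks can be filled with zero and every Taylor datum comes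
from a globally defined smooth map. Second, the data that $\Lambda$ keeps of a flipped jet depend
only on the data it keeps of the jet itself, through $((x,a),(b,C)) \mapsto ((x,b),(a,C^t))$
(`lambdaTaylor_flipTaylor2`). Hence $\hat\ell$ descends along $\Lambda$ (`Lambda_flipJet2_congr`).

Surjectivity then gives uniqueness of $\ell$ and transfers $\hat\ell\circ\hat\ell=\mathrm{id}$ to
$\ell$. The coordinate formula for $\ell$ is again linear, so $\ell$ is a smooth involution, hence a
diffeomorphism. -/

/-- A map that is smooth when read in the preferred charts, and maps the domain of the preferred
chart at each point into the domain of the preferred chart at its image, is smooth. -/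
theorem contMDiff_of_eqOn_charts {F F' N N' : Type*} [NormedAddCommGroup F] [NormedSpace ℝ F]
    [NormedAddCommGroup F'] [NormedSpace ℝ F'] [TopologicalSpace N] [ChartedSpace F N]
    [IsManifold 𝓘(ℝ, F) ∞ N] [TopologicalSpace N'] [ChartedSpace F' N']
    [IsManifold 𝓘(ℝ, F') ∞ N'] {f : N → N'} {T : F → F'} (hT : ContDiff ℝ ∞ T)
    (hf : ∀ z, ∀ w ∈ (chartAt F z).source,
      f w ∈ (chartAt F' (f z)).source ∧ chartAt F' (f z) (f w) = T (chartAt F z w)) :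
    ContMDiff 𝓘(ℝ, F) 𝓘(ℝ, F') ∞ f := by
  intro z
  have h1 : ContMDiffAt 𝓘(ℝ, F) 𝓘(ℝ, F) ∞ (chartAt F z) z :=
    contMDiffAt_of_mem_maximalAtlas (IsManifold.chart_mem_maximalAtlas z) (mem_chart_source F z)
  have hz := hf z z (mem_chart_source F z)
  have h2 : ContMDiffAt 𝓘(ℝ, F') 𝓘(ℝ, F') ∞ (chartAt F' (f z)).symm (T (chartAt F z z)) :=
    contMDiffAt_symm_of_mem_maximalAtlas (IsManifold.chart_mem_maximalAtlas (f z))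
      (hz.2 ▸ (chartAt F' (f z)).map_source hz.1)
  -- Continuity of `f` is not assumed: `hf` places the image of the whole chart domain inside one
  -- chart, so near `z` the map `f` equals this smooth composite.
  have h3 : ContMDiffAt 𝓘(ℝ, F) 𝓘(ℝ, F') ∞
      ((chartAt F' (f z)).symm ∘ T ∘ chartAt F z) z :=
    ContMDiffAt.comp z h2 (ContMDiffAt.comp z hT.contMDiff.contMDiffAt h1)
  refine h3.congr_of_eventuallyEq ?_
  filter_upwards [(chartAt F z).open_source.mem_nhds (mem_chart_source F z)] with w hw
  obtain ⟨hw1, hw2⟩ := hf z w hw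
  simp only [Function.comp_apply, ← hw2, (chartAt F' (f z)).left_inv hw1]

/-! ### The flip and `Λ` on Taylor data. -/

section Linear

variable {V E : Type*} [NormedAddCommGroup V] [NormedSpace ℝ V]
  [NormedAddCommGroup E] [NormedSpace ℝ E]

/-- The flip `(u, w) ↦ (w, u)` as a continuous linear equivalence. -/
abbrev flipEquiv (V : Type*) [NormedAddCommGroup V] [NormedSpace ℝ V] : (V × V) ≃L[ℝ] (V × V) :=
  ContinuousLinearEquiv.prodComm ℝ V V

/-- The effect of precomposition with the flip on second order Taylor data. -/
def flipTaylor2 (y : Model2 (V × V) E) : Model2 (V × V) E :=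
  (y.1, y.2.1.comp (flipEquiv V : (V × V) →L[ℝ] (V × V)),
    symPart (((ContinuousLinearMap.compL ℝ (V × V) (V × V) E).flip
      (flipEquiv V : (V × V) →L[ℝ] (V × V))).comp
        ((y.2.2 : (V × V) →L[ℝ] (V × V) →L[ℝ] E).comp
          (flipEquiv V : (V × V) →L[ℝ] (V × V)))))

theorem contDiff_flipTaylor2 :
    ContDiff ℝ ∞ (flipTaylor2 : Model2 (V × V) E → Model2 (V × V) E) := by
  have hB : ContDiff ℝ ∞ (fun y : Model2 (V × V) E =>
      (y.2.2 : (V × V) →L[ℝ] (V × V) →L[ℝ] E)) :=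
    contDiff_symBilin_coe.comp (contDiff_snd.comp contDiff_snd)
  have hA : ContDiff ℝ ∞ (fun y : Model2 (V × V) E => y.2.1) := contDiff_fst.comp contDiff_snd
  exact contDiff_fst.prodMk ((hA.clm_comp contDiff_const).prodMk
    (contDiff_symPart.comp (contDiff_const.clm_comp (hB.clm_comp contDiff_const))))

/-- Conjugating a symmetric form by the flip keeps it symmetric, so the `symPart` in `flipTaylor2`
changes nothing. -/
theorem coe_flipTaylor2_apply (y : Model2 (V × V) E) (a b : V × V) :
    ((flipTaylor2 y).2.2 : (V × V) →L[ℝ] (V × V) →L[ℝ] E) a b =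
      (y.2.2 : (V × V) →L[ℝ] (V × V) →L[ℝ] E) a.swap b.swap := by
  rw [flipTaylor2, symPart_of_symm]
  · rfl
  · intro v w
    exact y.2.2.2 v.swap w.swap

/-- The flip is linear and fixes the origin, so the second order chain rule has no term with a
second derivative of the inner map. -/
theorem taylor2_comp_flip {f : V × V → E} (hf : ContDiffAt ℝ ∞ f 0) :
    taylor2 (f ∘ flipEquiv V) = flipTaylor2 (taylor2 f) := by
  -- For a linear equivalence the chain rule holds at every point with no differentiability
  -- hypothesis. This gives an identity of functions, which can be differentiated again.
  have h1 : fderiv ℝ (f ∘ flipEquiv V) = fun u =>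
      (fderiv ℝ f (flipEquiv V u)).comp (flipEquiv V : (V × V) →L[ℝ] (V × V)) :=
    funext fun u => (flipEquiv V).comp_right_fderiv
  have h0 : flipEquiv V 0 = 0 := map_zero _
  have hdf : HasFDerivAt (fderiv ℝ f) (fderiv ℝ (fderiv ℝ f) 0) (flipEquiv V 0) := by
    rw [h0]
    exact ((hf.fderiv_right (m := ∞) (by simp)).differentiableAt (by simp)).hasFDerivAt
  have h2 := ((ContinuousLinearMap.compL ℝ (V × V) (V × V) E).flip
      (flipEquiv V : (V × V) →L[ℝ] (V × V))).hasFDerivAt.comp (0 : V × V)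
        (hdf.comp (0 : V × V) (flipEquiv V).hasFDerivAt)
  have h3 : fderiv ℝ (fderiv ℝ (f ∘ flipEquiv V)) 0 =
      ((ContinuousLinearMap.compL ℝ (V × V) (V × V) E).flip
        (flipEquiv V : (V × V) →L[ℝ] (V × V))).comp
          ((fderiv ℝ (fderiv ℝ f) 0).comp (flipEquiv V : (V × V) →L[ℝ] (V × V))) := by
    rw [h1]
    exact h2.fderiv
  have h4 := coe_taylor2 hf
  simp only [taylor2, flipTaylor2, Function.comp_apply] at h4 ⊢
  rw [h3, h4, h1]
  simp only [h0]

/-- The map `Λ` in charts: `(x, A, B) ↦ ((x, A_w), (A_u, B_uw))`. -/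
def lambdaTaylor (y : Model2 (V × V) E) : Model1 V (Model1 V E) :=
  ((y.1, y.2.1.comp (ContinuousLinearMap.inr ℝ V V)),
    (y.2.1.comp (ContinuousLinearMap.inl ℝ V V)).prod
      (((ContinuousLinearMap.compL ℝ V (V × V) E).flip (ContinuousLinearMap.inr ℝ V V)).comp
        ((y.2.2 : (V × V) →L[ℝ] (V × V) →L[ℝ] E).comp (ContinuousLinearMap.inl ℝ V V))))

/-- The flip of iterated first order Taylor data: `((x, a), (b, C)) ↦ ((x, b), (a, Cᵗ))`. -/
def flipTaylor11 (y : Model1 V (Model1 V E)) : Model1 V (Model1 V E) :=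
  ((y.1.1, (ContinuousLinearMap.fst ℝ E (V →L[ℝ] E)).comp y.2),
    y.1.2.prod ((ContinuousLinearMap.snd ℝ E (V →L[ℝ] E)).comp y.2).flip)

theorem contDiff_flipTaylor11 :
    ContDiff ℝ ∞ (flipTaylor11 : Model1 V (Model1 V E) → Model1 V (Model1 V E)) := by
  have ha : ContDiff ℝ ∞ (fun y : Model1 V (Model1 V E) => y.1.2) :=
    contDiff_snd.comp contDiff_fst
  have hf : ContDiff ℝ ∞ (fun y : Model1 V (Model1 V E) =>
      (ContinuousLinearMap.fst ℝ E (V →L[ℝ] E)).comp y.2) :=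
    contDiff_const.clm_comp contDiff_snd
  -- Transposition, and below the pairing of two operators, preserve the norm, so the bound 1 works
  -- for both.
  have hflip : ContDiff ℝ ∞ (fun C : V →L[ℝ] V →L[ℝ] E => C.flip) :=
    IsBoundedLinearMap.contDiff (IsLinearMap.with_bound
      ⟨ContinuousLinearMap.flip_add, ContinuousLinearMap.flip_smul⟩ 1 fun C => by
        rw [one_mul, ContinuousLinearMap.opNorm_flip])
  have hs : ContDiff ℝ ∞ (fun y : Model1 V (Model1 V E) =>
      ((ContinuousLinearMap.snd ℝ E (V →L[ℝ] E)).comp y.2).flip) :=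
    hflip.comp (contDiff_const.clm_comp contDiff_snd)
  have hprod : ContDiff ℝ ∞ (fun L : (V →L[ℝ] E) × (V →L[ℝ] V →L[ℝ] E) => L.1.prod L.2) :=
    IsBoundedLinearMap.contDiff (IsLinearMap.with_bound
      ⟨fun _ _ => rfl, fun _ _ => rfl⟩ 1 fun L => by
        rw [one_mul, ContinuousLinearMap.opNorm_prod])
  exact ((contDiff_fst.comp contDiff_fst).prodMk hf).prodMk
    (hprod.comp (ha.prodMk hs))

/-- The right-hand side sees the 2-jet only through `lambdaTaylor`; this is what allows the flip to
descend although `Λ` loses information. -/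
theorem lambdaTaylor_flipTaylor2 (y : Model2 (V × V) E) :
    lambdaTaylor (flipTaylor2 y) = flipTaylor11 (lambdaTaylor y) := by
  refine Prod.ext (Prod.ext rfl ?_) ?_
  · ext w
    simp [lambdaTaylor, flipTaylor2, flipTaylor11]
  · ext u w
    · simp [lambdaTaylor, flipTaylor2, flipTaylor11]
    · refine (coe_flipTaylor2_apply y (u, 0) (0, w)).trans ?_
      -- The flip turns the $uw$ block into the $wu$ block; symmetry of the second derivative
      -- identifies the latter with the transposed $uw$ block.
      exact y.2.2.2 (0, u) (w, 0)

/-- Only the mixed block of the second derivative is prescribed, so a preimage can be chosen whose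
two pure blocks vanish. -/
theorem lambdaTaylor_surjective :
    Function.Surjective (lambdaTaylor : Model2 (V × V) E → Model1 V (Model1 V E)) := by
  rintro ⟨⟨x, a⟩, D⟩
  let C : V →L[ℝ] V →L[ℝ] E := (ContinuousLinearMap.snd ℝ E (V →L[ℝ] E)).comp D
  let B : (V × V) →L[ℝ] (V × V) →L[ℝ] E :=
    C.bilinearComp (ContinuousLinearMap.fst ℝ V V) (ContinuousLinearMap.snd ℝ V V)
  -- The factor 2 cancels the half in `symPart`, which leaves `B` plus its transpose. On the pair
  -- `(u, 0)`, `(0, w)` the transpose contributes `C 0 0 = 0`, so the mixed block is exactly `C`.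
  refine ⟨(x, ((ContinuousLinearMap.fst ℝ E (V →L[ℝ] E)).comp D).coprod a,
    symPart ((2 : ℝ) • B)), Prod.ext (Prod.ext rfl ?_) ?_⟩
  · ext w
    simp [lambdaTaylor]
  · ext u w
    · simp [lambdaTaylor]
    · simp [lambdaTaylor, symPart, B, C]

end Linear

/-! ### The flip of 2-jets. -/

section Flip

variable {E : Type*} [NormedAddCommGroup E] [NormedSpace ℝ E]
  {V : Type*} [NormedAddCommGroup V] [NormedSpace ℝ V]
  {M : Type*} [TopologicalSpace M] [ChartedSpace E M] [IsManifold 𝓘(ℝ, E) ∞ M]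

theorem taylor2_comp_flipMap {e : OpenPartialHomeomorph M E} (he : e ∈ atlas E M)
    (φ : C^∞⟮𝓘(ℝ, V × V), V × V; 𝓘(ℝ, E), M⟯) (h : φ 0 ∈ e.source) :
    taylor2 (e ∘ φ.comp flipMap) = flipTaylor2 (taylor2 (e ∘ φ)) :=
  taylor2_comp_flip (contDiffAt_chart_comp he φ h)

/-- The flip `j²φ ↦ j²(φ ∘ 𝔣)` of `2`-jets. -/
def flipJet2 : Jet2 E (V × V) M → Jet2 E (V × V) M :=
  Quotient.lift (fun φ => j2 (φ.comp flipMap)) (by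
    intro φ ψ h
    have h0 : φ 0 = ψ 0 := h.1
    have hc := chart_mem_atlas E (φ 0)
    have hφ : φ 0 ∈ (chartAt E (φ 0)).source := mem_chart_source E (φ 0)
    have hψ : ψ 0 ∈ (chartAt E (φ 0)).source := h0 ▸ hφ
    -- The flip fixes the origin, so `hφ` and `hψ` also place the flipped maps in this chart.
    refine (Jet2.j2_eq_iff (φ := φ.comp flipMap) (ψ := ψ.comp flipMap) hc hφ hψ).2 ?_
    rw [taylor2_comp_flipMap hc φ hφ, taylor2_comp_flipMap hc ψ hψ,
      (Jet2.j2_eq_iff hc hφ hψ).1 (Quotient.sound h)])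

@[simp] theorem flipJet2_j2 (φ : C^∞⟮𝓘(ℝ, V × V), V × V; 𝓘(ℝ, E), M⟯) :
    flipJet2 (j2 φ) = j2 (φ.comp flipMap) := rfl

theorem base_flipJet2 (z : Jet2 E (V × V) M) : (flipJet2 z).base = z.base := by
  rw [← Jet2.j2_rep z]
  rfl

theorem flipJet2_involutive : Function.Involutive (flipJet2 (E := E) (V := V) (M := M)) := by
  intro z
  rw [← Jet2.j2_rep z]
  rfl

variable [FiniteDimensional ℝ V]

/-- The flip preserves base points, so the preferred charts at `z` and at its flip are induced by
the same chart of `M`, and `taylor2_comp_flipMap` applies. -/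
theorem chartAt_flipJet2 (z w : Jet2 E (V × V) M)
    (hw : w ∈ (chartAt (Model2 (V × V) E) z).source) :
    flipJet2 w ∈ (chartAt (Model2 (V × V) E) (flipJet2 z)).source ∧
      chartAt (Model2 (V × V) E) (flipJet2 z) (flipJet2 w) =
        flipTaylor2 (chartAt (Model2 (V × V) E) z w) := by
  rw [Jet2.mem_chartAt_source] at hw ⊢
  rw [base_flipJet2, base_flipJet2]
  refine ⟨hw, ?_⟩
  rw [← Jet2.j2_rep w] at hw ⊢
  have hw' : (w.rep.comp flipMap) 0 ∈ (chartAt E (flipJet2 z).base).source := by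
    rw [base_flipJet2]
    exact hw
  rw [flipJet2_j2, Jet2.chartAt_apply _ _ hw', Jet2.chartAt_apply _ _ hw, base_flipJet2]
  exact taylor2_comp_flipMap (chart_mem_atlas E z.base) w.rep hw

theorem contMDiff_flipJet2 :
    ContMDiff 𝓘(ℝ, Model2 (V × V) E) 𝓘(ℝ, Model2 (V × V) E) ∞
      (flipJet2 (E := E) (V := V) (M := M)) :=
  contMDiff_of_eqOn_charts contDiff_flipTaylor2 chartAt_flipJet2

variable (E V M) in
/-- The flip of `2`-jets as a diffeomorphism. -/
def flipJet2Diffeomorph : Jet2 E (V × V) M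
    ≃ₘ⟮𝓘(ℝ, Model2 (V × V) E), 𝓘(ℝ, Model2 (V × V) E)⟯ Jet2 E (V × V) M where
  -- The inverse is the map itself, so one smoothness proof serves both directions.
  toEquiv := flipJet2_involutive.toPerm
  contMDiff_toFun := contMDiff_flipJet2
  contMDiff_invFun := contMDiff_flipJet2

/-! ### `Λ` in charts and its surjectivity. -/

theorem base_base_Lambda (z : Jet2 E (V × V) M) : (Lambda z).base.base = z.base := by
  rw [← Jet2.j2_rep z]
  rfl

/-- Both levels of induced charts have as domain the full preimage of a chart domain below, so
membership is a condition on the point of `M` alone. -/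
theorem mem_chartAt_source_iterated (Z W : Jet1 (Model1 V E) V (Jet1 E V M)) :
    W ∈ (chartAt (Model1 V (Model1 V E)) Z).source ↔
      W.base.base ∈ (chartAt E Z.base.base).source := Iff.rfl

/-- In charts, `Λ` is `(x, A, B) ↦ ((x, A_w), (A_u, B_uw))`. -/
theorem chartAt_Lambda (Z : Jet1 (Model1 V E) V (Jet1 E V M))
    (φ : C^∞⟮𝓘(ℝ, V × V), V × V; 𝓘(ℝ, E), M⟯) (h : φ 0 ∈ (chartAt E Z.base.base).source) :
    chartAt (Model1 V (Model1 V E)) Z (Lambda (j2 φ)) =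
      lambdaTaylor (taylor2 (chartAt E Z.base.base ∘ φ)) := by
  have hc := chart_mem_atlas E Z.base.base
  refine (Jet1.chartAt_apply Z (doubleMap φ) h).trans (Prod.ext ?_ ?_)
  · exact (Jet1.chartAt_apply Z.base (slice φ 0) h).trans (taylor1_slice hc φ h)
  · refine (fderiv_chartAt_doubleMap Z.base φ h).trans ?_
    -- The second derivative of a smooth map is symmetric, so it coincides with the symmetrized
    -- component stored in `taylor2`.
    rw [← coe_taylor2 (contDiffAt_chart_comp hc φ h)]
    rfl

/-- In the chart at `Z`, surjectivity on Taylor data provides coordinates of a 2-jet,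
`exists_taylor2` realizes them by a global smooth map, and injectivity of the chart returns to jets.
-/
theorem Lambda_surjective : Function.Surjective (Lambda (E := E) (V := V) (M := M)) := by
  intro Z
  have hZ := mem_chart_source (Model1 V (Model1 V E)) Z
  obtain ⟨y, hy⟩ := lambdaTaylor_surjective (chartAt (Model1 V (Model1 V E)) Z Z)
  have hy1 : y.1 = (chartAt (Model1 V (Model1 V E)) Z Z).1.1 := by rw [← hy]; rfl
  have hyt : y.1 ∈ (chartAt E Z.base.base).target := by
    rw [hy1]
    exact (chartAt (Model1 V (Model1 V E)) Z).map_source hZ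
  obtain ⟨φ, hφ, hφy⟩ := exists_taylor2 (chart_mem_atlas E Z.base.base) hyt
  refine ⟨j2 φ, (chartAt (Model1 V (Model1 V E)) Z).injOn hφ hZ ?_⟩
  rw [chartAt_Lambda Z φ hφ, hφy, hy]

/-! ### Descent of the flip to iterated 1-jets. -/

/-- The flip of `2`-jets read through `Λ` in charts. -/
theorem chartAt_Lambda_flipJet2 (Z : Jet1 (Model1 V E) V (Jet1 E V M)) (z : Jet2 E (V × V) M)
    (hz : z.base ∈ (chartAt E Z.base.base).source) :
    chartAt (Model1 V (Model1 V E)) Z (Lambda (flipJet2 z)) =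
      flipTaylor11 (chartAt (Model1 V (Model1 V E)) Z (Lambda z)) := by
  rw [← Jet2.j2_rep z] at hz ⊢
  rw [flipJet2_j2, chartAt_Lambda Z _ hz, chartAt_Lambda Z (z.rep.comp flipMap) hz,
    taylor2_comp_flipMap (chart_mem_atlas E Z.base.base) z.rep hz, lambdaTaylor_flipTaylor2]

/-- This is well-definedness of the descended flip. Equal images under `Λ` force equal base points,
so both flipped jets are visible in one iterated chart, where `chartAt_Lambda_flipJet2` computes
their images from the common value of `Λ`. -/
theorem Lambda_flipJet2_congr {z z' : Jet2 E (V × V) M} (h : Lambda z = Lambda z') :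
    Lambda (flipJet2 z) = Lambda (flipJet2 z') := by
  have hb : z.base = z'.base := by rw [← base_base_Lambda, h, base_base_Lambda]
  have hz : z.base ∈ (chartAt E (Lambda z).base.base).source := by
    rw [base_base_Lambda]
    exact mem_chart_source E z.base
  have hz' : z'.base ∈ (chartAt E (Lambda z).base.base).source := hb ▸ hz
  refine (chartAt (Model1 V (Model1 V E)) (Lambda z)).injOn ?_ ?_ ?_
  · rwa [mem_chartAt_source_iterated, base_base_Lambda (flipJet2 z), base_flipJet2]
  · rwa [mem_chartAt_source_iterated, base_base_Lambda (flipJet2 z'), base_flipJet2]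
  · rw [chartAt_Lambda_flipJet2 _ z hz, chartAt_Lambda_flipJet2 _ z' hz', h]

/-- The flip of iterated `1`-jets induced through `Λ` by the flip of `2`-jets. -/
def flipJet11 (Z : Jet1 (Model1 V E) V (Jet1 E V M)) : Jet1 (Model1 V E) V (Jet1 E V M) :=
  Lambda (flipJet2 (Function.surjInv Lambda_surjective Z))

/-- The preimage chosen by `Function.surjInv` need not be `z`, but it has the same image under `Λ`,
which suffices. -/
theorem flipJet11_Lambda (z : Jet2 E (V × V) M) :
    flipJet11 (Lambda z) = Lambda (flipJet2 z) :=
  Lambda_flipJet2_congr (Function.surjInv_eq Lambda_surjective _)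

theorem flipJet11_involutive : Function.Involutive (flipJet11 (E := E) (V := V) (M := M)) := by
  intro Z
  obtain ⟨z, rfl⟩ := Lambda_surjective Z
  rw [flipJet11_Lambda, flipJet11_Lambda, flipJet2_involutive]

theorem base_base_flipJet11 (Z : Jet1 (Model1 V E) V (Jet1 E V M)) :
    (flipJet11 Z).base.base = Z.base.base := by
  obtain ⟨z, rfl⟩ := Lambda_surjective Z
  rw [flipJet11_Lambda, base_base_Lambda, base_base_Lambda, base_flipJet2]

/-- The preferred chart of the manifold of `1`-jets only depends on the preferred chart at the base
point. -/
theorem Jet1.chartAt_congr {z w : Jet1 E V M} (h : chartAt E z.base = chartAt E w.base) :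
    chartAt (Model1 V E) z = chartAt (Model1 V E) w := by
  -- The open partial homeomorphism depends on a proof of atlas membership as well as on the chart.
  -- With both charts and both proofs generalized, the equality can be eliminated.
  have key : ∀ {c c' : PartialEquiv (Jet1 E V M) (Model1 V E)}
      (hc : c ∈ (Jet1.core E V M).atlas) (hc' : c' ∈ (Jet1.core E V M).atlas), c = c' →
      (Jet1.core E V M).openPartialHomeomorph c hc =
        (Jet1.core E V M).openPartialHomeomorph c' hc' := by
    rintro c _ hc hc' rfl
    rfl
  refine key _ _ ?_
  change Jet1.chart (chartAt E z.base) (chart_mem_atlas E z.base) =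
    Jet1.chart (chartAt E w.base) (chart_mem_atlas E w.base)
  simp only [h]

theorem chartAt_iterated_congr {Z W : Jet1 (Model1 V E) V (Jet1 E V M)}
    (h : Z.base.base = W.base.base) :
    chartAt (Model1 V (Model1 V E)) Z = chartAt (Model1 V (Model1 V E)) W :=
  Jet1.chartAt_congr (Jet1.chartAt_congr (by rw [h]))

/-- The point of `M` under an iterated jet is preserved, so the charts at `Z` and at its flip
coincide; after lifting `W` through `Λ`, the formula is the one already found for 2-jets. -/
theorem chartAt_flipJet11 (Z W : Jet1 (Model1 V E) V (Jet1 E V M))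
    (hW : W ∈ (chartAt (Model1 V (Model1 V E)) Z).source) :
    flipJet11 W ∈ (chartAt (Model1 V (Model1 V E)) (flipJet11 Z)).source ∧
      chartAt (Model1 V (Model1 V E)) (flipJet11 Z) (flipJet11 W) =
        flipTaylor11 (chartAt (Model1 V (Model1 V E)) Z W) := by
  rw [chartAt_iterated_congr (base_base_flipJet11 Z)]
  rw [mem_chartAt_source_iterated] at hW ⊢
  rw [base_base_flipJet11]
  refine ⟨hW, ?_⟩
  obtain ⟨w, rfl⟩ := Lambda_surjective W
  rw [flipJet11_Lambda]
  exact chartAt_Lambda_flipJet2 Z w (base_base_Lambda w ▸ hW)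

theorem contMDiff_flipJet11 :
    ContMDiff 𝓘(ℝ, Model1 V (Model1 V E)) 𝓘(ℝ, Model1 V (Model1 V E)) ∞
      (flipJet11 (E := E) (V := V) (M := M)) :=
  contMDiff_of_eqOn_charts contDiff_flipTaylor11 chartAt_flipJet11

variable (E V M) in
/-- The flip of iterated `1`-jets as a diffeomorphism. -/
def flipJet11Diffeomorph : Jet1 (Model1 V E) V (Jet1 E V M)
    ≃ₘ⟮𝓘(ℝ, Model1 V (Model1 V E)), 𝓘(ℝ, Model1 V (Model1 V E))⟯
      Jet1 (Model1 V E) V (Jet1 E V M) where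
  toEquiv := flipJet11_involutive.toPerm
  contMDiff_toFun := contMDiff_flipJet11
  contMDiff_invFun := contMDiff_flipJet11

end Flip

end JetBundle

end

/-! ### Existence and uniqueness. -/

theorem theorem3 {E : Type*} [NormedAddCommGroup E] [NormedSpace ℝ E] [FiniteDimensional ℝ E]
    {M : Type*} [TopologicalSpace M] [ChartedSpace E M] [IsManifold 𝓘(ℝ, E) ∞ M] (p : ℕ) :
    ∃ lhat : J2 p E M ≃ₘ⟮𝓘(ℝ, J2Model p E), 𝓘(ℝ, J2Model p E)⟯ J2 p E M,
      (∀ φ : C^∞⟮𝓘(ℝ, EuclideanSpace ℝ (Fin p) × EuclideanSpace ℝ (Fin p)),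
          EuclideanSpace ℝ (Fin p) × EuclideanSpace ℝ (Fin p); 𝓘(ℝ, E), M⟯,
        lhat (j2 φ) = j2 (φ.comp flipMap)) ∧
      Function.Involutive lhat ∧
      ∃ l : JJ p E M ≃ₘ⟮𝓘(ℝ, JJModel p E), 𝓘(ℝ, JJModel p E)⟯ JJ p E M,
        (∀ z : J2 p E M, l (Lambda z) = Lambda (lhat z)) ∧
        Function.Involutive l ∧
        ∀ g : JJ p E M → JJ p E M, (∀ z : J2 p E M, g (Lambda z) = Lambda (lhat z)) → g = l := by
  refine ⟨flipJet2Diffeomorph E (EuclideanSpace ℝ (Fin p)) M, fun φ => rfl, flipJet2_involutive,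
    flipJet11Diffeomorph E (EuclideanSpace ℝ (Fin p)) M, flipJet11_Lambda, flipJet11_involutive,
    fun g hg => funext fun Z => ?_⟩
  -- Uniqueness among all maps, with no regularity required of `g`: every point is of the form
  -- `Lambda z`, where the value is prescribed.
  obtain ⟨z, rfl⟩ := Lambda_surjective Z
  exact (hg z).trans (flipJet11_Lambda z).symm
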